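/- Let $\xi$ be a random variable with $S$ scenarios $\xi^s=(\xi^s_1,\dots,\xi^s_{T-1})$ of probabilities $p_s$, $\sum_s p_s=1$. Write $x\in\mathbb{R}^{S\times n}$, $n=n_1+\dots+n_T$, as $x=(x^s_t)$ with $x^s_t\in\mathbb{R}^{n_t}$ the decision at stage $t$ under scenario $s$, and $x^s=(x^s_1,\dots,x^s_T)\in\mathbb{R}^n$. Let $$\mathcal{B}^s_t=\{\sigma:\ \xi^\sigma_\tau=\xi^s_\tau\ \text{for all}\ \tau\le t-1\},\qquad \mathcal{W}=\{x\in\mathbb{R}^{S\times n}:\ x^{s}_t=x^{\sigma}_t\ \text{for all}\ s,t\ \text{and all}\ \sigma\in\mathcal{B}^{s}_t\},$$ and consider the problem $$\min_{x\in\mathcal{W}}\ \sum_{s=1}^S p_s f^s(x^s),\qquad f^s:\mathbb{R}^n\to(-\infty,+\infty].\tag{P}$$ Assume that $p_s>0$ for all $s$; that the functions $f^s$ are convex, proper and lower semicontinuous; that (P) has a solution; and that $\mathcal{W}$ intersects the relative interior of the domain $\{x:\sum_s p_sf^s(x^s)<+\infty\}$ of the objective. Let $\mu>0$, let $q_s>0$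 for $s=1,\dots,S$, $\sum_s q_s=1$, and let $z^0\in\mathcal{W}$. For $z\in\mathbb{R}^{S\times n}$ let $\Pi z$ be defined by $$(\Pi z)^s_t=\frac{1}{\sum_{\sigma\in\mathcal{B}^s_t}p_\sigma}\sum_{\sigma\in\mathcal{B}^s_t}p_\sigma z^\sigma_t .$$ Randomized Progressive Hedging is the following iteration. For $k=0,1,\dots$, draw a scenario $s^k$, independently of the other draws, with $\mathbb{P}[s^k=s]=q_s$; compute only the row $x^{k+1,s^k}=(\Pi z^k)^{s^k}$; solve the subproblem $$y^{k+1,s^k}=\operatorname*{argmin}_{y\in\mathbb{R}^n}\Big\{f^{s^k}(y)+\frac1{2\mu}\big\|y-2x^{k+1,s^k}+z^{k,s^k}\big\|^2\Big\};$$ and set $z^{k+1,s^k}=z^{k,s^k}+y^{k+1,s^k}-x^{k+1,s^k}$ and $z^{k+1,s}=z^{k,s}$ for $s\ne s^k$. The output sequence is $\tilde x^k=\Pi z^k$. Then the algorithm is well defined (every such subproblem has exactly one minimizer); almost surely $\tilde x^k\in\mathcal{W}$ for all $k$; and almost surely $(\tilde x^k)$ converges to a solution of (P). -/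

import Mathlib

open MeasureTheory ProbabilityTheory Filter Topology

noncomputable section

/-- A decision along one scenario: an element of `ℝ^{n_1} × ⋯ × ℝ^{n_T} = ℝ^n`, with the Euclidean
norm. Stages are numbered `0, …, T - 1`. -/
abbrev Decision {T : ℕ} (n : Fin T → ℕ) : Type :=
  PiLp 2 (fun t : Fin T => EuclideanSpace ℝ (Fin (n t)))

/-- A full variable `x ∈ ℝ^{S × n}`: one decision per scenario. -/
abbrev FullVar (S : ℕ) {T : ℕ} (n : Fin T → ℕ) : Type :=
  Fin S → Decision n

/-- Convexity of an extended-real-valued function: its epigraph is convex. -/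
def ConvexEReal {E : Type*} [AddCommGroup E] [Module ℝ E] (f : E → EReal) : Prop :=
  Convex ℝ {q : E × ℝ | f q.1 ≤ (q.2 : EReal)}

/-- Properness: the value `-∞` is never taken, and some value is not `+∞`. -/
def ProperEReal {E : Type*} (f : E → EReal) : Prop :=
  (∀ x, f x ≠ ⊥) ∧ ∃ x, f x ≠ ⊤

/-- A minimizer of `g` over the whole space (meaningful when there is one). -/
def argmin {E : Type*} [Nonempty E] (g : E → EReal) : E :=
  Classical.epsilon (fun y => IsMinOn g Set.univ y)

/-- The data of a multistage stochastic program with `S` scenarios and `T` stages: the values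
`ξ^s = (ξ^s_1, …, ξ^s_{T-1})`, the probabilities `p_s`, and the costs `f^s`. -/
structure MultistageProblem (S T : ℕ) (n : Fin T → ℕ) (Ξ : Fin (T - 1) → Type*) where
  scen : Fin S → (τ : Fin (T - 1)) → Ξ τ
  prob : Fin S → ℝ
  prob_sum : ∑ s, prob s = 1
  cost : Fin S → Decision n → EReal

namespace MultistageProblem

variable {S T : ℕ} {n : Fin T → ℕ} {Ξ : Fin (T - 1) → Type*}

/-- Two scenarios have the same history when the decision of stage `t` is taken. With stages and
observations both numbered from `0`, the observations made before stage `t` are those with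
index `< t`, so that at the first stage the condition is void. -/
def SameHistory (M : MultistageProblem S T n Ξ) (t : Fin T) (s₁ s₂ : Fin S) : Prop :=
  ∀ τ : Fin (T - 1), (τ : ℕ) < (t : ℕ) → M.scen s₁ τ = M.scen s₂ τ

/-- The non-anticipativity subspace `𝓦` of `ℝ^{S × n}`. -/
def nonanticipative (M : MultistageProblem S T n Ξ) : Submodule ℝ (FullVar S n) where
  carrier := {x | ∀ (t : Fin T) (s₁ s₂ : Fin S), M.SameHistory t s₁ s₂ → x s₁ t = x s₂ t}
  add_mem' := by
    intro a b ha hb t s₁ s₂ h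
    simp [ha t s₁ s₂ h, hb t s₁ s₂ h]
  zero_mem' := by
    intro t s₁ s₂ _
    rfl
  smul_mem' := by
    intro c a ha t s₁ s₂ h
    simp [ha t s₁ s₂ h]

/-- The objective `∑ s, p_s f^s(x^s)`. -/
def objective (M : MultistageProblem S T n Ξ) (x : FullVar S n) : EReal :=
  ∑ s, (M.prob s : EReal) * M.cost s (x s)

/-- The domain of the objective. -/
def domain (M : MultistageProblem S T n Ξ) : Set (FullVar S n) :=
  {x | M.objective x < ⊤}

/-- `x` solves the problem of minimizing the objective over `𝓦`. -/
def IsSolution (M : MultistageProblem S T n Ξ) (x : FullVar S n) : Prop :=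
  x ∈ M.nonanticipative ∧ IsMinOn M.objective (M.nonanticipative : Set (FullVar S n)) x

open Classical in
/-- The bundle of the scenarios that cannot be distinguished from `s` at stage `t`. -/
def bundle (M : MultistageProblem S T n Ξ) (s : Fin S) (t : Fin T) : Finset (Fin S) :=
  Finset.univ.filter (fun σ => M.SameHistory t s σ)

/-- The probability-weighted average of `z` over the bundles of scenario `s`, stage by stage. -/
def bundleAvg (M : MultistageProblem S T n Ξ) (z : FullVar S n) (s : Fin S) : Decision n :=
  WithLp.toLp 2 (fun t =>
    (∑ σ ∈ M.bundle s t, M.prob σ)⁻¹ • ∑ σ ∈ M.bundle s t, M.prob σ • z σ t)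

/-- The objective of the proximal subproblem of scenario `s`:
`y ↦ f^s(y) + (1 / (2 μ)) ‖y - 2 x^s + z^s‖²` with `x^s` the bundle average of `z`. -/
def subproblem (M : MultistageProblem S T n Ξ) (mu : ℝ) (z : FullVar S n) (s : Fin S)
    (y : Decision n) : EReal :=
  M.cost s y + ((1 / (2 * mu) * ‖y - (2 : ℝ) • M.bundleAvg z s + z s‖ ^ 2 : ℝ) : EReal)

/-- One iteration of Randomized Progressive Hedging, from `z`, with the scenario `s` drawn. -/
def rphStep (M : MultistageProblem S T n Ξ) (mu : ℝ) (z : FullVar S n) (s : Fin S) :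
    FullVar S n :=
  Function.update z s (z s + argmin (M.subproblem mu z s) - M.bundleAvg z s)

/-- The iterate `z^k` of Randomized Progressive Hedging when scenario `draw k` is drawn at
iteration `k`. -/
def rphIterate (M : MultistageProblem S T n Ξ) (mu : ℝ) (z₀ : FullVar S n) (draw : ℕ → Fin S) :
    ℕ → FullVar S n
  | 0 => z₀
  | k + 1 => M.rphStep mu (rphIterate M mu z₀ draw k) (draw k)

/-- The output `x̃^k` of Randomized Progressive Hedging. -/
def rphOutput (M : MultistageProblem S T n Ξ) (mu : ℝ) (z₀ : FullVar S n) (draw : ℕ → Fin S)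
    (k : ℕ) : FullVar S n :=
  fun s => M.bundleAvg (M.rphIterate mu z₀ draw k) s

end MultistageProblem

end

/-! Let `B` be the inner product on `ℝ^{S × n}` weighted by the probabilities. The bundle average is
the `B`-orthogonal projection onto the non-anticipativity subspace, so that a step of the algorithm
replaces one random row of `z` by the same row of `T z`, where `T` is the Douglas–Rachford operator
of the objective and of that projection. Both the projection and the proximal map being firmly
nonexpansive for `B`, so is `T`. A fixed point of `T` amounts to a solution `x` together with a
multiplier: a vector `B`-orthogonal to the subspace whose rows are subgradients of the costs at the
rows of `x`. The relative interior hypothesis provides a multiplier, hence a fixed point, by Riesz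
extension in the space of points and heights.

Weight now the squared distance to a fixed point by `p_s / q_s` instead of `p_s`: its conditional
expectation decreases at each step by at least the `B`-square of `T z - z`. By supermartingale
convergence, almost surely its limit exists and `T z - z` tends to zero, simultaneously for a
countable dense set of fixed points. Opial's argument then gives a fixed point as the limit of `z`,
and the projection of that limit solves the problem. -/

noncomputable section

open scoped InnerProductSpace

section ProximalPoint

lemma ConvexEReal.le_of_le {E : Type*} [AddCommGroup E] [Module ℝ E] {f : E → EReal}
    (hf : ConvexEReal f) {x y : E} {a b t : ℝ} (hx : f x ≤ a) (hy : f y ≤ b) (ht0 : 0 ≤ t)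
    (ht1 : t ≤ 1) : f (x + t • (y - x)) ≤ ((a + t * (b - a) : ℝ) : EReal) := by
  have h := hf (x := (x, a)) hx (y := (y, b)) hy (sub_nonneg.2 ht1) ht0 (by ring)
  simp only [Set.mem_ofPred_eq, Prod.smul_mk, Prod.mk_add_mk, smul_eq_mul] at h
  convert h using 2
  · module
  · ring_nf

lemma nonneg_of_forall_nonneg_add_mul {a b : ℝ} (h : ∀ t ∈ Set.Ioc (0 : ℝ) 1, 0 ≤ a + t * b) :
    0 ≤ a := by
  have hlim : Tendsto (fun t : ℝ => a + t * b) (𝓝[>] 0) (𝓝 (a + 0 * b)) :=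
    (Continuous.tendsto (by fun_prop) 0).mono_left nhdsWithin_le_nhds
  simpa using ge_of_tendsto hlim (mem_of_superset (Ioc_mem_nhdsGT zero_lt_one) h)

variable {E : Type*} [NormedAddCommGroup E]

/-- The function `y ↦ f y + (1 / (2 * mu)) * ‖y - c‖ ^ 2`, whose minimizer is the proximal point
of `f` at `c` with step `mu`. -/
def proxObjective (f : E → EReal) (mu : ℝ) (c y : E) : EReal :=
  f y + ((1 / (2 * mu) * ‖y - c‖ ^ 2 : ℝ) : EReal)

/-- The proximal point of `f` at `c` with step `mu`. As with `argmin`, the value is meaningful only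
if `proxObjective f mu c` has a minimizer. -/
def proxPoint (f : E → EReal) (mu : ℝ) (c : E) : E :=
  argmin (proxObjective f mu c)

lemma proxObjective_of_eq_coe {f : E → EReal} {y : E} {r : ℝ} (h : f y = r) (mu : ℝ) (c : E) :
    proxObjective f mu c y = ((r + 1 / (2 * mu) * ‖y - c‖ ^ 2 : ℝ) : EReal) := by
  rw [proxObjective, h, EReal.coe_add]

lemma proxObjective_of_eq_top {f : E → EReal} {y : E} (h : f y = ⊤) (mu : ℝ) (c : E) :
    proxObjective f mu c y = ⊤ := by
  rw [proxObjective, h, EReal.top_add_coe]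

lemma lowerSemicontinuous_proxObjective {f : E → EReal} (hf : LowerSemicontinuous f) (mu : ℝ)
    (c : E) : LowerSemicontinuous (proxObjective f mu c) := by
  refine hf.add' (Continuous.lowerSemicontinuous ?_) fun x => ?_
  · exact continuous_coe_real_ereal.comp (by fun_prop)
  · exact EReal.continuousAt_add (Or.inr (EReal.coe_ne_bot _)) (Or.inr (EReal.coe_ne_top _))

lemma ne_top_of_isMinOn_proxObjective {f : E → EReal} (hf : ProperEReal f) {mu : ℝ} {c y : E}
    (h : IsMinOn (proxObjective f mu c) Set.univ y) : f y ≠ ⊤ := by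
  intro hy
  obtain ⟨x, hx⟩ := hf.2
  obtain ⟨r, hr⟩ : ∃ r : ℝ, (r : EReal) = f x := CanLift.prf _ ⟨hx, hf.1 x⟩
  have hle : proxObjective f mu c y ≤ proxObjective f mu c x := h (Set.mem_univ x)
  rw [proxObjective_of_eq_top hy, proxObjective_of_eq_coe hr.symm, top_le_iff] at hle
  exact EReal.coe_ne_top _ hle

variable [InnerProductSpace ℝ E]

/-- `u` is a subgradient of `f` at `y`, where `f` is finite. The subgradient inequality is stated
against the points `(w, ρ)` of the epigraph of `f`, so that it only involves real numbers. -/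
def IsSubgradientAt (f : E → EReal) (u y : E) : Prop :=
  ∃ r : ℝ, f y = r ∧ ∀ (w : E) (ρ : ℝ), f w ≤ ρ → r + ⟪u, w - y⟫_ℝ ≤ ρ

lemma IsSubgradientAt.inner_sub_nonneg {f : E → EReal} {u u' y y' : E}
    (h : IsSubgradientAt f u y) (h' : IsSubgradientAt f u' y') :
    0 ≤ ⟪u - u', y - y'⟫_ℝ := by
  obtain ⟨r, hr, hle⟩ := h
  obtain ⟨r', hr', hle'⟩ := h'
  have h1 := hle y' r' hr'.le
  have h2 := hle' y r hr.le
  rw [← neg_sub y y', inner_neg_right] at h1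
  rw [inner_sub_left]
  linarith

lemma IsSubgradientAt.inner_sub_sub_nonneg {f : E → EReal} {mu : ℝ} (hmu : 0 < mu)
    {c c' y y' : E} (h : IsSubgradientAt f (mu⁻¹ • (c - y)) y)
    (h' : IsSubgradientAt f (mu⁻¹ • (c' - y')) y') :
    0 ≤ ⟪(c - c') - (y - y'), y - y'⟫_ℝ := by
  have hmono := h.inner_sub_nonneg h'
  rw [← smul_sub, real_inner_smul_left, sub_sub_sub_comm] at hmono
  exact nonneg_of_mul_nonneg_right hmono (inv_pos.2 hmu)

lemma IsSubgradientAt.prox_unique {f : E → EReal} {mu : ℝ} (hmu : 0 < mu) {c y y' : E}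
    (h : IsSubgradientAt f (mu⁻¹ • (c - y)) y) (h' : IsSubgradientAt f (mu⁻¹ • (c - y')) y') :
    y = y' := by
  have hmono := h.inner_sub_sub_nonneg hmu h'
  rw [sub_self, zero_sub, inner_neg_left, neg_nonneg] at hmono
  exact sub_eq_zero.1 (real_inner_self_nonpos.1 hmono)

lemma norm_add_smul_sub_sq (y w c : E) (t : ℝ) :
    ‖y + t • (w - y) - c‖ ^ 2 =
      ‖y - c‖ ^ 2 - 2 * t * ⟪c - y, w - y⟫_ℝ + t ^ 2 * ‖w - y‖ ^ 2 := by
  have hsplit : y + t • (w - y) - c = t • (w - y) - (c - y) := by abel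
  rw [hsplit, norm_sub_sq_real, norm_smul, real_inner_smul_left, real_inner_comm, mul_pow,
    Real.norm_eq_abs, sq_abs, norm_sub_rev c y]
  ring

lemma isSubgradientAt_of_isMinOn_proxObjective {f : E → EReal} (hconv : ConvexEReal f)
    (hf : ProperEReal f) {mu : ℝ} (hmu : 0 < mu) {c y : E}
    (h : IsMinOn (proxObjective f mu c) Set.univ y) :
    IsSubgradientAt f (mu⁻¹ • (c - y)) y := by
  obtain ⟨r, hr⟩ : ∃ r : ℝ, (r : EReal) = f y :=
    CanLift.prf _ ⟨ne_top_of_isMinOn_proxObjective hf h, hf.1 y⟩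
  refine ⟨r, hr.symm, fun w ρ hw => ?_⟩
  have hsegment : ∀ t ∈ Set.Ioc (0 : ℝ) 1,
      0 ≤ (ρ - r - mu⁻¹ * ⟪c - y, w - y⟫_ℝ) + t * (1 / (2 * mu) * ‖w - y‖ ^ 2) := by
    intro t ht
    have hmin : proxObjective f mu c y ≤ proxObjective f mu c (y + t • (w - y)) :=
      h (Set.mem_univ _)
    have hreal := hmin.trans (add_le_add_left (hconv.le_of_le hr.ge hw ht.1.le ht.2) _)
    rw [proxObjective_of_eq_coe hr.symm, ← EReal.coe_add, EReal.coe_le_coe_iff,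
      norm_add_smul_sub_sq] at hreal
    refine nonneg_of_mul_nonneg_right (a := t) ?_ ht.1
    have hscale : t * mu⁻¹ * ⟪c - y, w - y⟫_ℝ =
        1 / (2 * mu) * (2 * t * ⟪c - y, w - y⟫_ℝ) := by field_simp
    linear_combination hreal + hscale
  have hlimit := nonneg_of_forall_nonneg_add_mul hsegment
  rw [real_inner_smul_left]
  linarith

/-- The class `Γ₀(E)` of convex analysis: the convex, proper, lower semicontinuous functions. -/
structure IsClosedProperConvex (f : E → EReal) : Prop where
  convex : ConvexEReal f
  proper : ProperEReal f
  lowerSemicontinuous : LowerSemicontinuous f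

variable [FiniteDimensional ℝ E] {f : E → EReal}

lemma exists_lowerBound_on_unitBall (hf : LowerSemicontinuous f) (hbot : ∀ x, f x ≠ ⊥)
    {x₀ : E} {r : ℝ} (hr : f x₀ = r) :
    ∃ m ≤ r, ∀ w, ‖w - x₀‖ ≤ 1 → (m : EReal) ≤ f w := by
  have hmem : x₀ ∈ Metric.closedBall x₀ 1 := Metric.mem_closedBall_self zero_le_one
  obtain ⟨a, -, hmin⟩ := LowerSemicontinuousOn.exists_isMinOn ⟨x₀, hmem⟩
    (isCompact_closedBall x₀ 1) (hf.lowerSemicontinuousOn _)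
  have har : f a ≤ r := (hmin hmem).trans hr.le
  obtain ⟨m, hm⟩ : ∃ m : ℝ, (m : EReal) = f a :=
    CanLift.prf _ ⟨ne_top_of_le_ne_top (EReal.coe_ne_top r) har, hbot a⟩
  refine ⟨m, EReal.coe_le_coe_iff.1 (hm ▸ har), fun w hw => hm ▸ hmin ?_⟩
  rwa [Metric.mem_closedBall, dist_eq_norm]

namespace IsClosedProperConvex

variable (hf : IsClosedProperConvex f)
include hf

-- Convexity along the segment from `x₀` to `w` propagates the lower bound on the unit ball.
lemma exists_linear_minorant :
    ∃ (x₀ : E) (r m : ℝ), f x₀ = r ∧ m ≤ r ∧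
      ∀ (w : E) (ρ : ℝ), f w ≤ ρ → m - ‖w - x₀‖ * (r - m) ≤ ρ := by
  obtain ⟨x₀, hx₀⟩ := hf.proper.2
  obtain ⟨r, hr⟩ : ∃ r : ℝ, (r : EReal) = f x₀ := CanLift.prf _ ⟨hx₀, hf.proper.1 x₀⟩
  obtain ⟨m, hmr, hball⟩ :=
    exists_lowerBound_on_unitBall hf.lowerSemicontinuous hf.proper.1 hr.symm
  refine ⟨x₀, r, m, hr.symm, hmr, fun w ρ hw => ?_⟩
  rcases le_total ‖w - x₀‖ 1 with hd | hd
  · have hmρ : m ≤ ρ := EReal.coe_le_coe_iff.1 ((hball w hd).trans hw)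
    linarith [mul_nonneg (norm_nonneg (w - x₀)) (sub_nonneg.2 hmr)]
  · have hd0 : 0 < ‖w - x₀‖ := one_pos.trans_le hd
    have hconv := hf.convex.le_of_le (t := ‖w - x₀‖⁻¹) hr.ge hw (by positivity)
      (inv_le_one_of_one_le₀ hd)
    have hm := EReal.coe_le_coe_iff.1
      ((hball _ (by simp [norm_smul, hd0.ne'])).trans hconv)
    have hscale := mul_le_mul_of_nonneg_left hm hd0.le
    rw [mul_add, mul_inv_cancel_left₀ hd0.ne'] at hscale
    linarith

variable {mu : ℝ} (hmu : 0 < mu) (c : E)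
include hmu

lemma exists_le_proxObjective_of_lt_norm :
    ∃ (x₀ : E) (R : ℝ), 0 ≤ R ∧
      ∀ w, R < ‖w - x₀‖ → proxObjective f mu c x₀ ≤ proxObjective f mu c w := by
  obtain ⟨x₀, r, m, hr, hmr, hlow⟩ := hf.exists_linear_minorant
  obtain ⟨a, ha⟩ : ∃ a, ‖x₀ - c‖ = a := ⟨_, rfl⟩
  have ha0 : 0 ≤ a := ha ▸ norm_nonneg _
  have hk0 : 0 ≤ mu * (r - m) := mul_nonneg hmu.le (sub_nonneg.2 hmr)
  refine ⟨x₀, 2 * a + 4 * (mu * (r - m)) + 1, by positivity, fun w hw => ?_⟩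
  by_cases htop : f w = ⊤
  · exact proxObjective_of_eq_top htop mu c ▸ le_top
  obtain ⟨ρ, hρ⟩ : ∃ ρ : ℝ, (ρ : EReal) = f w := CanLift.prf _ ⟨htop, hf.proper.1 w⟩
  rw [proxObjective_of_eq_coe hr, proxObjective_of_eq_coe hρ.symm, EReal.coe_le_coe_iff, ha]
  have hlow' := hlow w ρ hρ.ge
  generalize hd : ‖w - x₀‖ = d at hw hlow'
  have hnorm : d - a ≤ ‖w - c‖ := by
    rw [← hd, ← ha, ← sub_sub_sub_cancel_right w x₀ c]
    linarith [norm_sub_le (w - c) (x₀ - c)]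
  have hsq : (d - a) ^ 2 ≤ ‖w - c‖ ^ 2 := pow_le_pow_left₀ (by linarith) hnorm 2
  have hquad : 2 * (mu * (r - m)) * (1 + d) + a ^ 2 ≤ (d - a) ^ 2 := by
    have : 1 * (2 * (mu * (r - m)) + 1) ≤ d * (d - 2 * a - 2 * (mu * (r - m))) :=
      mul_le_mul (by linarith) (by linarith) (by positivity) (by linarith)
    nlinarith
  calc r + 1 / (2 * mu) * a ^ 2
      = m - d * (r - m) + 1 / (2 * mu) * (2 * (mu * (r - m)) * (1 + d) + a ^ 2) := by
        field_simp
        ring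
    _ ≤ ρ + 1 / (2 * mu) * ‖w - c‖ ^ 2 := by
        gcongr
        exact hquad.trans hsq

lemma exists_isMinOn_proxObjective : ∃ y, IsMinOn (proxObjective f mu c) Set.univ y := by
  obtain ⟨x₀, R, hR, hfar⟩ := hf.exists_le_proxObjective_of_lt_norm hmu c
  have hmem : x₀ ∈ Metric.closedBall x₀ R := Metric.mem_closedBall_self hR
  obtain ⟨y, -, hmin⟩ := LowerSemicontinuousOn.exists_isMinOn ⟨x₀, hmem⟩
    (isCompact_closedBall x₀ R)
    ((lowerSemicontinuous_proxObjective hf.lowerSemicontinuous mu c).lowerSemicontinuousOn _)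
  refine ⟨y, fun w _ => ?_⟩
  rcases le_or_gt ‖w - x₀‖ R with hw | hw
  · exact hmin (by rwa [Metric.mem_closedBall, dist_eq_norm])
  · exact (hmin hmem).trans (hfar w hw)

lemma existsUnique_isMinOn_proxObjective : ∃! y, IsMinOn (proxObjective f mu c) Set.univ y := by
  obtain ⟨y, hy⟩ := hf.exists_isMinOn_proxObjective hmu c
  refine ⟨y, hy, fun w hw => IsSubgradientAt.prox_unique (f := f) (c := c) hmu ?_ ?_⟩
  · exact isSubgradientAt_of_isMinOn_proxObjective hf.convex hf.proper hmu hw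
  · exact isSubgradientAt_of_isMinOn_proxObjective hf.convex hf.proper hmu hy

lemma isSubgradientAt_proxPoint :
    IsSubgradientAt f (mu⁻¹ • (c - proxPoint f mu c)) (proxPoint f mu c) :=
  isSubgradientAt_of_isMinOn_proxObjective hf.convex hf.proper hmu
    (Classical.epsilon_spec (hf.exists_isMinOn_proxObjective hmu c))

variable {c}

lemma proxPoint_eq {y : E} (h : IsSubgradientAt f (mu⁻¹ • (c - y)) y) : proxPoint f mu c = y :=
  (hf.isSubgradientAt_proxPoint hmu c).prox_unique hmu h

end IsClosedProperConvex

end ProximalPoint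

section WeightedSums

variable {ι : Type*} [Fintype ι]

/-- The bilinear form `∑ i, p i * ⟪x i, y i⟫` on a product of inner product spaces. -/
def weightedInner {E : ι → Type*} [∀ i, NormedAddCommGroup (E i)]
    [∀ i, InnerProductSpace ℝ (E i)] (p : ι → ℝ) : LinearMap.BilinForm ℝ (∀ i, E i) :=
  ∑ i, p i • (innerₗ (E i)).compl₁₂ (LinearMap.proj i) (LinearMap.proj i)

/-- The squared distance `∑ i, p i * dist (x i) (y i) ^ 2` on a product of metric spaces. -/
def weightedSqDist {E : ι → Type*} [∀ i, MetricSpace (E i)] (p : ι → ℝ) (x y : ∀ i, E i) : ℝ :=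
  ∑ i, p i * dist (x i) (y i) ^ 2

/-- The separable function `x ↦ ∑ i, p i * f i (x i)` on a product. -/
def weightedSum {E : ι → Type*} (p : ι → ℝ) (f : ∀ i, E i → EReal) (x : ∀ i, E i) : EReal :=
  ∑ i, (p i : EReal) * f i (x i)

section Metric

variable {E : ι → Type*} [∀ i, MetricSpace (E i)] {p : ι → ℝ}

@[simp]
lemma weightedSqDist_self (x : ∀ i, E i) : weightedSqDist p x x = 0 := by
  simp [weightedSqDist]

lemma continuous_weightedSqDist :
    Continuous fun x : (∀ i, E i) × (∀ i, E i) => weightedSqDist p x.1 x.2 := by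
  unfold weightedSqDist
  fun_prop

lemma weightedSqDist_update [DecidableEq ι] (x y : ∀ i, E i) (i : ι) (v : E i) :
    weightedSqDist p (Function.update x i v) y =
      weightedSqDist p x y + p i * (dist v (y i) ^ 2 - dist (x i) (y i) ^ 2) := by
  rw [← sub_eq_iff_eq_add', weightedSqDist, weightedSqDist, ← Finset.sum_sub_distrib,
    Finset.sum_eq_single i (fun j _ hj => by simp [hj]) (by simp)]
  simp [mul_sub]

variable (hp : ∀ i, 0 < p i)
include hp

lemma weightedSqDist_nonneg (x y : ∀ i, E i) : 0 ≤ weightedSqDist p x y :=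
  Finset.sum_nonneg fun i _ => mul_nonneg (hp i).le (sq_nonneg _)

lemma dist_apply_sq_le_weightedSqDist (x y : ∀ i, E i) (i : ι) :
    dist (x i) (y i) ^ 2 ≤ (p i)⁻¹ * weightedSqDist p x y := by
  rw [← div_eq_inv_mul, le_div_iff₀' (hp i)]
  exact Finset.single_le_sum (f := fun j => p j * dist (x j) (y j) ^ 2)
    (fun j _ => mul_nonneg (hp j).le (sq_nonneg _)) (Finset.mem_univ i)

lemma exists_dist_sq_le_weightedSqDist :
    ∃ C, 0 ≤ C ∧ ∀ x y : ∀ i, E i, dist x y ^ 2 ≤ C * weightedSqDist p x y := by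
  have hinv : ∀ i ∈ Finset.univ, 0 ≤ (p i)⁻¹ := fun i _ => (inv_pos.2 (hp i)).le
  refine ⟨∑ i, (p i)⁻¹, Finset.sum_nonneg hinv, fun x y => ?_⟩
  have hV := weightedSqDist_nonneg hp x y
  rw [← Real.le_sqrt dist_nonneg (mul_nonneg (Finset.sum_nonneg hinv) hV),
    dist_pi_le_iff (Real.sqrt_nonneg _)]
  intro i
  refine Real.le_sqrt_of_sq_le ((dist_apply_sq_le_weightedSqDist hp x y i).trans ?_)
  exact mul_le_mul_of_nonneg_right (Finset.single_le_sum hinv (Finset.mem_univ i)) hV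

lemma weightedSqDist_eq_zero_iff {x y : ∀ i, E i} : weightedSqDist p x y = 0 ↔ x = y := by
  refine ⟨fun h => ?_, fun h => h ▸ weightedSqDist_self x⟩
  obtain ⟨C, -, hC⟩ := exists_dist_sq_le_weightedSqDist (E := E) hp
  have hdist := hC x y
  rw [h, mul_zero] at hdist
  exact dist_eq_zero.1 (pow_eq_zero_iff two_ne_zero |>.1 (hdist.antisymm (sq_nonneg _)))

lemma continuous_of_weightedSqDist_le {T : (∀ i, E i) → ∀ i, E i}
    (hT : ∀ x y, weightedSqDist p (T x) (T y) ≤ weightedSqDist p x y) : Continuous T := by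
  refine continuous_iff_continuousAt.2 fun y => tendsto_iff_dist_tendsto_zero.2 ?_
  obtain ⟨C, hC0, hC⟩ := exists_dist_sq_le_weightedSqDist (E := E) hp
  have hlim : Tendsto (fun x => √(C * weightedSqDist p x y)) (𝓝 y) (𝓝 0) := by
    have hcont : Continuous fun x => √(C * weightedSqDist p x y) :=
      ((continuous_weightedSqDist.comp (by fun_prop : Continuous fun x => (x, y))).const_mul
        C).sqrt
    simpa using hcont.tendsto y
  refine squeeze_zero (fun _ => dist_nonneg) (fun x => Real.le_sqrt_of_sq_le ?_) hlim
  exact (hC _ _).trans (mul_le_mul_of_nonneg_left (hT x y) hC0)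

end Metric

section InnerProduct

variable {E : ι → Type*} [∀ i, NormedAddCommGroup (E i)] [∀ i, InnerProductSpace ℝ (E i)]
  {p : ι → ℝ}

lemma weightedInner_apply (x y : ∀ i, E i) :
    weightedInner p x y = ∑ i, p i * ⟪x i, y i⟫_ℝ := by
  simp [weightedInner, LinearMap.sum_apply]

lemma weightedInner_single [DecidableEq ι] (x : ∀ i, E i) (i : ι) (v : E i) :
    weightedInner p x (Pi.single i v) = p i * ⟪x i, v⟫_ℝ := by
  rw [weightedInner_apply, Finset.sum_eq_single i (fun j _ hj => by simp [hj]) (by simp),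
    Pi.single_eq_same]

lemma weightedInner_isSymm : (weightedInner p : LinearMap.BilinForm ℝ (∀ i, E i)).IsSymm :=
  ⟨fun x y => by simp [weightedInner_apply, real_inner_comm]⟩

lemma weightedInner_sub_self (x y : ∀ i, E i) :
    weightedInner p (x - y) (x - y) = weightedSqDist p x y := by
  simp only [weightedInner_apply, Pi.sub_apply, real_inner_self_eq_norm_sq, weightedSqDist,
    dist_eq_norm]

lemma exists_weightedInner_eq [∀ i, FiniteDimensional ℝ (E i)] (hp : ∀ i, 0 < p i)
    (ℓ : (∀ i, E i) →ₗ[ℝ] ℝ) : ∃ u, weightedInner p u = ℓ := by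
  classical
  refine ⟨fun i => (p i)⁻¹ • (InnerProductSpace.toDual ℝ (E i)).symm
    (LinearMap.toContinuousLinearMap (ℓ.comp (LinearMap.single ℝ E i))), LinearMap.pi_ext' ?_⟩
  intro i
  ext v
  rw [LinearMap.comp_apply, LinearMap.comp_apply, LinearMap.single_apply, weightedInner_single]
  simp [real_inner_smul_left, mul_inv_cancel_left₀ (hp i).ne']

end InnerProduct

section ExtendedReal

variable {E : ι → Type*} {p : ι → ℝ} {f : ∀ i, E i → EReal}

lemma weightedSum_of_eq_coe {x : ∀ i, E i} {r : ι → ℝ} (h : ∀ i, f i (x i) = r i) :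
    weightedSum p f x = ((∑ i, p i * r i : ℝ) : EReal) := by
  classical
  rw [weightedSum]
  induction (Finset.univ : Finset ι) using Finset.induction_on with
  | empty => simp
  | insert i s hi ih =>
    rw [Finset.sum_insert hi, Finset.sum_insert hi, ih, h, EReal.coe_add, EReal.coe_mul]

variable (hp : ∀ i, 0 < p i) (hbot : ∀ i x, f i x ≠ ⊥)
include hp hbot

lemma weightedSum_eq_top {x : ∀ i, E i} {i : ι} (hi : f i (x i) = ⊤) :
    weightedSum p f x = ⊤ := by
  classical
  rw [weightedSum, ← Finset.add_sum_erase _ _ (Finset.mem_univ i), hi,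
    EReal.coe_mul_top_of_pos (hp i)]
  refine EReal.top_add_of_ne_bot ?_
  induction Finset.univ.erase i using Finset.induction_on with
  | empty => simp
  | insert j s hj ih =>
    rw [Finset.sum_insert hj, Ne, EReal.add_eq_bot_iff, not_or, EReal.mul_eq_bot]
    exact ⟨by simp [hbot, (hp j).not_gt], ih⟩

lemma exists_coe_eq_of_weightedSum_ne_top {x : ∀ i, E i} (hx : weightedSum p f x ≠ ⊤) :
    ∃ r : ι → ℝ, ∀ i, f i (x i) = r i :=
  ⟨fun i => (f i (x i)).toReal, fun i => (EReal.coe_toReal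
    (fun hi => hx (weightedSum_eq_top hp hbot hi)) (hbot i _)).symm⟩

lemma weightedSum_le_coe_iff {x : ∀ i, E i} {a : ℝ} :
    weightedSum p f x ≤ a ↔ ∃ r : ι → ℝ, (∀ i, f i (x i) ≤ r i) ∧ ∑ i, p i * r i ≤ a := by
  constructor
  · intro hx
    obtain ⟨r, hr⟩ := exists_coe_eq_of_weightedSum_ne_top hp hbot
      (ne_top_of_le_ne_top (EReal.coe_ne_top a) hx)
    rw [weightedSum_of_eq_coe hr, EReal.coe_le_coe_iff] at hx
    exact ⟨r, fun i => (hr i).le, hx⟩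
  · rintro ⟨r, hr, ha⟩
    calc weightedSum p f x ≤ weightedSum p (fun i _ => (r i : EReal)) x :=
          Finset.sum_le_sum fun i _ =>
            mul_le_mul_of_nonneg_left (hr i) (EReal.coe_nonneg.2 (hp i).le)
      _ = ((∑ i, p i * r i : ℝ) : EReal) := weightedSum_of_eq_coe fun _ => rfl
      _ ≤ a := EReal.coe_le_coe_iff.2 ha

lemma convexEReal_weightedSum [∀ i, AddCommGroup (E i)] [∀ i, Module ℝ (E i)]
    (hf : ∀ i, ConvexEReal (f i)) : ConvexEReal (weightedSum p f) := by
  rintro ⟨x, r⟩ hx ⟨y, r'⟩ hy a b ha hb hab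
  obtain ⟨ρ, hρ, hr⟩ := (weightedSum_le_coe_iff hp hbot).1 hx
  obtain ⟨ρ', hρ', hr'⟩ := (weightedSum_le_coe_iff hp hbot).1 hy
  refine (weightedSum_le_coe_iff hp hbot).2 ⟨fun i => a * ρ i + b * ρ' i, fun i => ?_, ?_⟩
  · exact hf i (x := (x i, ρ i)) (hρ i) (y := (y i, ρ' i)) (hρ' i) ha hb hab
  · calc ∑ i, p i * (a * ρ i + b * ρ' i) = a * ∑ i, p i * ρ i + b * ∑ i, p i * ρ' i := by
          simp only [mul_add, mul_left_comm (p _), Finset.sum_add_distrib, Finset.mul_sum]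
      _ ≤ a * r + b * r' := by gcongr

end ExtendedReal

end WeightedSums

section Duality

variable {V : Type*} [AddCommGroup V] [Module ℝ V]

lemma eq_zero_or_exists_smul_of_mem_hull {s : Set V} (hs : Convex ℝ s) {x : V}
    (hx : x ∈ PointedCone.hull ℝ s) : x = 0 ∨ ∃ t : ℝ, 0 < t ∧ ∃ y ∈ s, t • y = x := by
  suffices h : x = 0 ∨ x ∈ ConvexCone.hull ℝ s from
    h.imp_right (ConvexCone.mem_hull_of_convex hs).1
  induction hx using Submodule.span_induction with
  | mem x hx => exact Or.inr (ConvexCone.subset_hull hx)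
  | zero => exact Or.inl rfl
  | add x y _ _ hx hy =>
    rcases hx with rfl | hx
    · rwa [zero_add]
    rcases hy with rfl | hy
    · rw [add_zero]
      exact Or.inr hx
    exact Or.inr (ConvexCone.add_mem _ hx hy)
  | smul a x _ hx =>
    rcases hx with rfl | hx
    · exact Or.inl (smul_zero a)
    rcases a.2.eq_or_lt with ha | ha
    · rw [show a = 0 from Subtype.ext ha.symm]
      exact Or.inl (zero_smul _ x)
    · exact Or.inr (ConvexCone.smul_mem _ ha hx)

-- The M. Riesz extension theorem for the cone generated by `C`, applied to `(0, r) ↦ r`.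
lemma exists_linearMap_le_snd {C : Set (V × ℝ)} (hC : Convex ℝ C)
    (hnonneg : ∀ r, ((0 : V), r) ∈ C → 0 ≤ r)
    (habs : ∀ h : V, ∃ t > (0 : ℝ), ∃ r, (t • h, r) ∈ C) :
    ∃ ℓ : V →ₗ[ℝ] ℝ, ∀ x r, (x, r) ∈ C → ℓ x ≤ r := by
  let f : V × ℝ →ₗ.[ℝ] ℝ := ⟨Submodule.prod ⊥ ⊤, (LinearMap.snd ℝ V ℝ).domRestrict _⟩
  have hpos : ∀ p : f.domain, (p : V × ℝ) ∈ PointedCone.hull ℝ C → 0 ≤ f p := by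
    rintro ⟨⟨h, ρ⟩, hdom⟩ hmem
    obtain rfl : h = 0 := hdom.1
    rcases eq_zero_or_exists_smul_of_mem_hull hC hmem with h0 | ⟨t, ht, ⟨x, r⟩, hx, hxeq⟩
    · exact (congrArg Prod.snd h0).ge
    · obtain ⟨h1, rfl⟩ := Prod.mk.inj hxeq
      obtain rfl : x = 0 := (smul_eq_zero_iff_right ht.ne').1 h1
      exact mul_nonneg ht.le (hnonneg r hx)
  have hdense : ∀ p : V × ℝ, ∃ d : f.domain, (d : V × ℝ) + p ∈ PointedCone.hull ℝ C := by
    rintro ⟨h, ρ⟩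
    obtain ⟨t, ht, r, hr⟩ := habs h
    refine ⟨⟨(0, t⁻¹ * r - ρ), by simp [f]⟩, ?_⟩
    have hscaled := (PointedCone.hull ℝ C).smul_mem (inv_pos.2 ht).le (Submodule.subset_span hr)
    simpa [ht.ne'] using hscaled
  obtain ⟨g, hgf, hg⟩ := riesz_extension (PointedCone.hull ℝ C) f hpos hdense
  have hsnd : ∀ r : ℝ, g (0, r) = r := fun r => hgf ⟨(0, r), by simp [f]⟩
  refine ⟨-(g.comp (LinearMap.inl ℝ V ℝ)), fun x r hx => ?_⟩
  have hsum : 0 ≤ g ((x, 0) + (0, r)) := hg _ (Submodule.subset_span (by simpa using hx))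
  rw [map_add, hsnd] at hsum
  simpa [neg_le_iff_add_nonneg'] using hsum

lemma linearMap_eq_zero_of_forall_le {ℓ : V →ₗ[ℝ] ℝ} {W : Submodule ℝ V} {b : ℝ}
    (h : ∀ w ∈ W, ℓ w ≤ b) {w : V} (hw : w ∈ W) : ℓ w = 0 := by
  by_contra hne
  have hle := h (((b + 1) / ℓ w) • w) (W.smul_mem _ hw)
  rw [map_smul, smul_eq_mul, div_mul_cancel₀ _ hne] at hle
  linarith

lemma exists_add_smul_mem_of_mem_intrinsicInterior [TopologicalSpace V] [ContinuousAdd V]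
    [ContinuousSMul ℝ V] {s : Set V} {a l : V} (ha : a ∈ intrinsicInterior ℝ s)
    (hl : l ∈ (affineSpan ℝ s).direction) : ∃ ε : ℝ, 0 < ε ∧ a + ε • l ∈ s := by
  obtain ⟨a', ha', rfl⟩ := ha
  have hmem : ∀ t : ℝ, t • l + (a' : V) ∈ affineSpan ℝ s := fun t =>
    AffineSubspace.vadd_mem_of_mem_direction (Submodule.smul_mem _ t hl) a'.2
  let line : ℝ → affineSpan ℝ s := fun t => ⟨t • l + (a' : V), hmem t⟩
  have hline : Continuous line := Continuous.subtype_mk (by fun_prop) _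
  have hzero : line 0 = a' := Subtype.ext (by simp [line])
  have hnhds : ∀ᶠ t in 𝓝 (0 : ℝ), line t ∈ ((↑) ⁻¹' s : Set (affineSpan ℝ s)) :=
    hline.continuousAt.eventually_mem (by rw [hzero]; exact mem_interior_iff_mem_nhds.1 ha')
  obtain ⟨ε, hε, hε0⟩ := ((hnhds.filter_mono nhdsWithin_le_nhds).and
    (self_mem_nhdsWithin (s := Set.Ioi (0 : ℝ)))).exists
  exact ⟨ε, hε0, by rwa [add_comm]⟩

lemma exists_linearMap_of_forall_le_of_absorbing {epi : Set (V × ℝ)} (hconv : Convex ℝ epi)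
    {W : Submodule ℝ V} {c : ℝ} (hmin : ∀ w ∈ W, ∀ r, (w, r) ∈ epi → c ≤ r)
    (habs : ∀ h : V, ∃ t > (0 : ℝ), ∃ x r, (x, r) ∈ epi ∧ x - t • h ∈ W) :
    ∃ ℓ : V →ₗ[ℝ] ℝ, (∀ w ∈ W, ℓ w = 0) ∧ ∀ x r, (x, r) ∈ epi → c + ℓ x ≤ r := by
  have hC : Convex ℝ {p : V × ℝ | ∃ w ∈ W, (p.1 + w, p.2 + c) ∈ epi} := by
    rintro ⟨x, r⟩ ⟨w, hw, h⟩ ⟨x', r'⟩ ⟨w', hw', h'⟩ a b ha hb hab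
    refine ⟨a • w + b • w', W.add_mem (W.smul_mem a hw) (W.smul_mem b hw'), ?_⟩
    convert hconv h h' ha hb hab using 1
    ext
    · simp only [Prod.fst_add, Prod.smul_fst, smul_add]
      abel
    · simp only [Prod.snd_add, Prod.smul_snd, smul_eq_mul]
      linear_combination -c * hab
  obtain ⟨ℓ, hℓ⟩ := exists_linearMap_le_snd hC
    (by
      rintro r ⟨w, hw, h⟩
      rw [zero_add] at h
      linarith [hmin w hw _ h])
    (by
      intro h
      obtain ⟨t, ht, x, r, hx, hxW⟩ := habs h
      exact ⟨t, ht, r - c, _, hxW, by simpa using hx⟩)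
  have hle : ∀ x r, (x, r) ∈ epi → ∀ w ∈ W, ℓ (x - w) ≤ r - c := fun x r hx w hw =>
    hℓ _ _ ⟨w, hw, by simpa using hx⟩
  refine ⟨ℓ, fun w hw => ?_, fun x r hx => ?_⟩
  · obtain ⟨-, -, x, r, hx, -⟩ := habs 0
    refine linearMap_eq_zero_of_forall_le (b := r - c - ℓ x) (fun w hw => ?_) hw
    have := hle x r hx (-w) (W.neg_mem hw)
    rw [sub_neg_eq_add, map_add] at this
    linarith
  · have := hle x r hx 0 W.zero_mem
    rw [sub_zero] at this
    linarith

-- `W` is enlarged by a complement `N` of `W ⊔ L`, with `L` the direction of the domain: this makes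
-- the epigraph absorbing modulo `W ⊔ N` and adds no point of the domain to `W`.
lemma exists_linearMap_of_forall_le [TopologicalSpace V] [ContinuousAdd V]
    [ContinuousSMul ℝ V] {epi : Set (V × ℝ)} (hconv : Convex ℝ epi) {W : Submodule ℝ V} {c : ℝ}
    (hmin : ∀ w ∈ W, ∀ r, (w, r) ∈ epi → c ≤ r)
    (hri : ((W : Set V) ∩ intrinsicInterior ℝ (Prod.fst '' epi)).Nonempty) :
    ∃ ℓ : V →ₗ[ℝ] ℝ, (∀ w ∈ W, ℓ w = 0) ∧ ∀ x r, (x, r) ∈ epi → c + ℓ x ≤ r := by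
  obtain ⟨a, haW, ha⟩ := hri
  let L := (affineSpan ℝ (Prod.fst '' epi)).direction
  have hsub : ∀ x r, (x, r) ∈ epi → x - a ∈ L := fun x r hx =>
    AffineSubspace.vsub_mem_direction (subset_affineSpan ℝ _ ⟨_, hx, rfl⟩)
      (subset_affineSpan ℝ _ (intrinsicInterior_subset ha))
  obtain ⟨N, hN⟩ := Submodule.exists_isCompl (W ⊔ L)
  obtain ⟨ℓ, hℓ, hle⟩ := exists_linearMap_of_forall_le_of_absorbing hconv (W := W ⊔ N) (c := c)
    (by
      intro v hv r hr
      obtain ⟨w, hw, y, hy, rfl⟩ := Submodule.mem_sup.1 hv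
      have hyWL : y ∈ W ⊔ L := by
        rw [show y = (a - w) + (w + y - a) by abel]
        exact Submodule.add_mem_sup (W.sub_mem haW hw) (hsub _ r hr)
      obtain rfl : y = 0 := Submodule.disjoint_def.1 hN.disjoint y hyWL hy
      exact hmin _ (by rwa [add_zero]) r hr)
    (by
      intro h
      obtain ⟨v, hv, y, hy, rfl⟩ := Submodule.mem_sup.1
        (hN.sup_eq_top ▸ Submodule.mem_top : h ∈ W ⊔ L ⊔ N)
      obtain ⟨w, hw, l, hl, rfl⟩ := Submodule.mem_sup.1 hv
      obtain ⟨ε, hε, ⟨x, r⟩, hx, rfl : x = a + ε • l⟩ :=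
        exists_add_smul_mem_of_mem_intrinsicInterior ha hl
      refine ⟨ε, hε, _, r, hx, ?_⟩
      rw [show a + ε • l - ε • (w + l + y) = (a - ε • w) + -(ε • y) by module]
      exact Submodule.add_mem_sup (W.sub_mem haW (W.smul_mem ε hw)) (N.neg_mem (N.smul_mem ε hy)))
  exact ⟨ℓ, fun w hw => hℓ w (Submodule.mem_sup_left hw), hle⟩

lemma fst_image_epigraph {X : Type*} (F : X → EReal) :
    Prod.fst '' {q : X × ℝ | F q.1 ≤ (q.2 : EReal)} = {x | F x < ⊤} := by
  ext x
  constructor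
  · rintro ⟨⟨x, r⟩, hr, rfl⟩
    exact lt_of_le_of_lt hr (EReal.coe_lt_top r)
  · intro hx
    obtain ⟨r, hr, -⟩ := EReal.lt_iff_exists_real_btwn.1 hx
    exact ⟨(x, r), hr.le, rfl⟩

section Separable

variable {ι : Type*} [Fintype ι] {E : ι → Type*} [∀ i, NormedAddCommGroup (E i)]
  [∀ i, InnerProductSpace ℝ (E i)] {p : ι → ℝ} {f : ∀ i, E i → EReal} {W : Submodule ℝ (∀ i, E i)}
  {x : ∀ i, E i}

lemma exists_multiplier [∀ i, FiniteDimensional ℝ (E i)] (hp : ∀ i, 0 < p i)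
    (hconv : ∀ i, ConvexEReal (f i)) (hbot : ∀ i x, f i x ≠ ⊥)
    (hri : ((W : Set (∀ i, E i)) ∩ intrinsicInterior ℝ {x | weightedSum p f x < ⊤}).Nonempty)
    (hxW : x ∈ W) (hx : IsMinOn (weightedSum p f) W x) :
    ∃ u, (∀ w ∈ W, weightedInner p u w = 0) ∧ ∀ i, IsSubgradientAt (f i) (u i) (x i) := by
  classical
  have hfin : weightedSum p f x < ⊤ := by
    obtain ⟨a, haW, ha⟩ := hri
    have hadom : a ∈ {x | weightedSum p f x < ⊤} := intrinsicInterior_subset ha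
    exact (show weightedSum p f x ≤ _ from hx haW).trans_lt hadom
  obtain ⟨r, hr⟩ := exists_coe_eq_of_weightedSum_ne_top hp hbot hfin.ne
  obtain ⟨ℓ, hℓ, hle⟩ := exists_linearMap_of_forall_le (convexEReal_weightedSum hp hbot hconv)
    (W := W) (c := ∑ i, p i * r i)
    (fun w hw ρ hρ => EReal.coe_le_coe_iff.1 <|
      (weightedSum_of_eq_coe hr).ge.trans ((hx hw).trans hρ))
    (by rwa [fst_image_epigraph])
  obtain ⟨u, rfl⟩ := exists_weightedInner_eq hp ℓ
  refine ⟨u, hℓ, fun i => ⟨r i, hr i, fun v ρ hv => ?_⟩⟩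
  have hmem : weightedSum p f (x + Pi.single i (v - x i)) ≤
      ((∑ j, p j * r j + p i * (ρ - r i) : ℝ) : EReal) := by
    refine (weightedSum_le_coe_iff hp hbot).2 ⟨r + Pi.single i (ρ - r i), fun j => ?_, ?_⟩
    · rcases eq_or_ne j i with rfl | hj
      · simpa using hv
      · simp [hj, hr]
    · rw [← dotProduct_single]
      exact (dotProduct_add p r _).le
  have hslope : p i * ⟪u i, v - x i⟫_ℝ ≤ p i * (ρ - r i) := by
    have h := hle _ (∑ j, p j * r j + p i * (ρ - r i)) hmem
    rwa [map_add, hℓ x hxW, zero_add, weightedInner_single, add_le_add_iff_left] at h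
  linarith [le_of_mul_le_mul_left hslope (hp i)]

lemma isMinOn_of_multiplier (hp : ∀ i, 0 < p i) (hbot : ∀ i x, f i x ≠ ⊥) (hxW : x ∈ W)
    {u : ∀ i, E i} (hu : ∀ w ∈ W, weightedInner p u w = 0)
    (hsub : ∀ i, IsSubgradientAt (f i) (u i) (x i)) : IsMinOn (weightedSum p f) W x := by
  choose r hr hle using hsub
  refine fun w hw => EReal.le_of_forall_lt_iff_le.1 fun ρ hρ => ?_
  obtain ⟨ρ', hρ', hsum⟩ := (weightedSum_le_coe_iff hp hbot).1 hρ.le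
  rw [weightedSum_of_eq_coe hr, EReal.coe_le_coe_iff]
  calc ∑ i, p i * r i = ∑ i, p i * r i + weightedInner p u (w - x) := by
        rw [hu _ (W.sub_mem hw hxW), add_zero]
    _ = ∑ i, p i * (r i + ⟪u i, w i - x i⟫_ℝ) := by
        simp only [weightedInner_apply, mul_add, Finset.sum_add_distrib, Pi.sub_apply]
    _ ≤ ∑ i, p i * ρ' i := by
        gcongr with i
        · exact (hp i).le
        · exact hle i _ _ (hρ' i)
    _ ≤ ρ := hsum

end Separable

end Duality

section RandomIteration

variable {X ι Ω : Type*}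

/-- The trajectory of the iteration `x ↦ g x i` started at `x₀`, when `i = d k` at step `k`. -/
def randomIterate (g : X → ι → X) (x₀ : X) (d : ℕ → ι) : ℕ → X
  | 0 => x₀
  | k + 1 => g (randomIterate g x₀ d k) (d k)

lemma exists_forall_norm_randomIterate_le [Finite ι] (g : X → ι → X) (x₀ : X) (k : ℕ)
    (V : X → ℝ) : ∃ C, ∀ d, ‖V (randomIterate g x₀ d k)‖ ≤ C := by
  induction k generalizing V with
  | zero => exact ⟨‖V x₀‖, fun _ => le_rfl⟩
  | succ k ih =>
    choose C hC using fun i => ih fun x => V (g x i)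
    obtain ⟨B, hB⟩ := (Set.finite_range C).bddAbove
    exact ⟨B, fun d => (hC (d k) d).trans (hB ⟨d k, rfl⟩)⟩

variable {mΩ : MeasurableSpace Ω} {μ : Measure Ω} [MeasurableSpace ι]

/-- The filtration of the strict past of a sequence of draws: at time `k`, the draws of index
`< k` are known. -/
def pastFiltration (draw : ℕ → Ω → ι) (hmeas : ∀ k, Measurable (draw k)) : Filtration ℕ mΩ where
  seq k := ⨆ j ∈ Set.Iio k, MeasurableSpace.comap (draw j) inferInstance
  mono' _ _ h := biSup_mono fun _ hj => lt_of_lt_of_le hj h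
  le' _ := iSup₂_le fun j _ => (hmeas j).comap_le

variable {draw : ℕ → Ω → ι}

lemma indep_comap_pastFiltration (hmeas : ∀ k, Measurable (draw k)) (hindep : iIndepFun draw μ)
    (k : ℕ) :
    Indep (MeasurableSpace.comap (draw k) inferInstance) (pastFiltration draw hmeas k) μ := by
  simpa [pastFiltration] using indep_iSup_of_disjoint (fun j => (hmeas j).comap_le) hindep
    (S := {k}) (T := Set.Iio k) (by simp)

lemma measurable_pastFiltration_succ (hmeas : ∀ k, Measurable (draw k)) (k : ℕ) :
    Measurable[pastFiltration draw hmeas (k + 1)] (draw k) :=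
  (comap_measurable (draw k)).mono
    (le_biSup (fun j => MeasurableSpace.comap (draw j) inferInstance) k.lt_succ_self) le_rfl

lemma stronglyMeasurable_randomIterate [Countable ι] [MeasurableSingletonClass ι]
    (hmeas : ∀ k, Measurable (draw k)) (g : X → ι → X) (x₀ : X) (k : ℕ) (V : X → ℝ) :
    StronglyMeasurable[pastFiltration draw hmeas k]
      fun ω => V (randomIterate g x₀ (draw · ω) k) := by
  let _ : MeasurableSpace X := ⊤
  suffices h : Measurable[pastFiltration draw hmeas k]
      fun ω => randomIterate g x₀ (draw · ω) k from
    (measurable_from_top.comp h).stronglyMeasurable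
  induction k with
  | zero => exact measurable_const
  | succ k ih =>
    have hg : Measurable fun y : X × ι => g y.1 y.2 :=
      measurable_from_prod_countable_left fun _ => measurable_from_top
    exact hg.comp ((ih.mono ((pastFiltration draw hmeas).mono k.le_succ) le_rfl).prodMk
      (measurable_pastFiltration_succ hmeas k))

lemma integrable_randomIterate [Finite ι] [MeasurableSingletonClass ι] [IsFiniteMeasure μ]
    (hmeas : ∀ k, Measurable (draw k)) (g : X → ι → X) (x₀ : X) (k : ℕ) (V : X → ℝ) :
    Integrable (fun ω => V (randomIterate g x₀ (draw · ω) k)) μ := by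
  obtain ⟨C, hC⟩ := exists_forall_norm_randomIterate_le g x₀ k V
  exact .of_bound ((stronglyMeasurable_randomIterate hmeas g x₀ k V).mono
    ((pastFiltration draw hmeas).le k)).aestronglyMeasurable C (ae_of_all _ fun ω => hC _)

end RandomIteration

section Supermartingale

variable {Ω : Type*} {m mΩ : MeasurableSpace Ω} {μ : Measure Ω}

lemma condExp_apply_of_indep {ι : Type*} [Fintype ι] [MeasurableSpace ι]
    [MeasurableSingletonClass ι] [IsFiniteMeasure μ] (hm : m ≤ mΩ) {F : Ω → ι → ℝ} {d : Ω → ι}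
    (hd : Measurable d) (hindep : Indep (MeasurableSpace.comap d inferInstance) m μ)
    (hF : ∀ i, StronglyMeasurable[m] (F · i)) (hint : ∀ i, Integrable (F · i) μ) :
    μ[fun ω => F ω (d ω) | m] =ᵐ[μ] fun ω => ∑ i, μ.real (d ⁻¹' {i}) * F ω i := by
  classical
  let ind (i : ι) : Ω → ℝ := (d ⁻¹' {i}).indicator 1
  have hset (i : ι) : MeasurableSet (d ⁻¹' {i}) := hd (measurableSet_singleton i)
  have hind (i : ι) : Integrable (ind i) μ := (integrable_const (1 : ℝ)).indicator (hset i)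
  have hprod (i : ι) : Integrable ((F · i) * ind i) μ := by
    refine ((hint i).indicator (hset i)).congr (ae_of_all _ fun ω => ?_)
    simp [ind, Set.indicator_apply]
  have hdecomp : (fun ω => F ω (d ω)) = ∑ i, (F · i) * ind i := by
    ext ω
    simp [ind, Set.indicator_apply, Finset.sum_apply, eq_comm]
  have hterm (i : ι) : μ[(F · i) * ind i | m] =ᵐ[μ] fun ω => μ.real (d ⁻¹' {i}) * F ω i := by
    have hmean : μ[ind i | m] =ᵐ[μ] fun _ => μ[ind i] :=
      condExp_indep_eq hd.comap_le hm
        (stronglyMeasurable_one.indicator ⟨{i}, measurableSet_singleton i, rfl⟩) hindep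
    filter_upwards [condExp_mul_of_stronglyMeasurable_left (hF i) (hprod i) (hind i), hmean]
      with ω hω hmeanω
    rw [hω, Pi.mul_apply, hmeanω, integral_indicator_one (hset i), mul_comm]
  rw [hdecomp]
  filter_upwards [condExp_finsetSum (fun i _ => hprod i) m, ae_all_iff.2 hterm] with ω hω htermω
  rw [hω, Finset.sum_apply]
  exact Finset.sum_congr rfl fun i _ => htermω i

variable {ℱ : Filtration ℕ mΩ}

lemma ae_exists_tendsto_of_supermartingale [IsFiniteMeasure μ] {U : ℕ → Ω → ℝ}
    (hU : Supermartingale U ℱ μ) (hnonneg : ∀ k ω, 0 ≤ U k ω) :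
    ∀ᵐ ω ∂μ, ∃ c, Tendsto (fun k => U k ω) atTop (𝓝 c) := by
  have hbdd : ∀ k, eLpNorm ((-U) k) 1 μ ≤ (∫ ω, U 0 ω ∂μ).toNNReal := fun k => by
    rw [Pi.neg_apply, eLpNorm_neg, eLpNorm_one_eq_lintegral_enorm,
      ← ofReal_integral_norm_eq_lintegral_enorm (hU.integrable k), ENNReal.ofReal]
    refine ENNReal.coe_le_coe.2 (Real.toNNReal_mono ?_)
    simpa only [Real.norm_of_nonneg (hnonneg k _), setIntegral_univ] using
      hU.setIntegral_le k.zero_le MeasurableSet.univ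
  filter_upwards [hU.neg.exists_ae_tendsto_of_bdd hbdd] with ω ⟨c, hc⟩
  exact ⟨-c, by simpa using hc.neg⟩

-- The partial sums of the decrements compensate `V` into a nonnegative supermartingale.
lemma ae_exists_tendsto_and_tendsto_zero [IsFiniteMeasure μ] {V D : ℕ → Ω → ℝ}
    (hVmeas : StronglyAdapted ℱ V) (hDmeas : StronglyAdapted ℱ D) (hVint : ∀ k, Integrable (V k) μ)
    (hDint : ∀ k, Integrable (D k) μ) (hV : ∀ k ω, 0 ≤ V k ω) (hD : ∀ k ω, 0 ≤ D k ω)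
    (hdesc : ∀ k, μ[V (k + 1) | ℱ k] ≤ᵐ[μ] V k - D k) :
    ∀ᵐ ω ∂μ, (∃ c, Tendsto (fun k => V k ω) atTop (𝓝 c)) ∧
      Tendsto (fun k => D k ω) atTop (𝓝 0) := by
  let A (k : ℕ) : Ω → ℝ := ∑ j ∈ Finset.range k, D j
  have hAnonneg (k : ℕ) (ω : Ω) : 0 ≤ A k ω := by
    simpa [A] using Finset.sum_nonneg fun j _ => hD j ω
  have hAmeas (k i : ℕ) (hi : i ≤ k + 1) : StronglyMeasurable[ℱ k] (A i) :=
    Finset.stronglyMeasurable_sum _ fun j hj => (hDmeas j).mono (ℱ.mono (by grind))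
  have hAint (k : ℕ) : Integrable (A k) μ := integrable_finsetSum' _ fun j _ => hDint j
  have hsuper : Supermartingale (V + A) ℱ μ := by
    refine supermartingale_nat (fun k => (hVmeas k).add (hAmeas k k k.le_succ))
      (fun k => (hVint k).add (hAint k)) fun k => ?_
    have hA := condExp_of_stronglyMeasurable (ℱ.le k) (hAmeas k _ le_rfl) (hAint (k + 1))
    filter_upwards [condExp_add (hVint (k + 1)) (hAint (k + 1)) (ℱ k), hdesc k] with ω hω hdescω
    refine hω.le.trans ((add_le_add_left hdescω _).trans_eq ?_)
    rw [hA]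
    simp [A, Finset.sum_range_succ]
  filter_upwards [ae_exists_tendsto_of_supermartingale hsuper
    fun k ω => add_nonneg (hV k ω) (hAnonneg k ω)] with ω ⟨c, hc⟩
  obtain ⟨B, hB⟩ := hc.bddAbove_range
  have hsum : Summable (D · ω) := summable_of_sum_range_le (hD · ω) fun k =>
    (by simpa [A] using (le_add_of_nonneg_left (hV k ω)).trans (hB ⟨k, rfl⟩))
  refine ⟨⟨c - ∑' j, D j ω, ?_⟩, hsum.tendsto_atTop_zero⟩
  exact (hc.sub hsum.hasSum.tendsto_sum_nat).congr fun k => by simp [A]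

end Supermartingale

section Convergence

theorem ae_tendsto_of_sum_mul_le_sub {X ι Ω : Type*} [Fintype ι] [MeasurableSpace ι]
    [MeasurableSingletonClass ι] [MeasurableSpace Ω] {μ : Measure Ω} [IsFiniteMeasure μ]
    {draw : ℕ → Ω → ι} (hmeas : ∀ k, Measurable (draw k)) (hindep : iIndepFun draw μ) {q : ι → ℝ}
    (hlaw : ∀ k i, μ.real (draw k ⁻¹' {i}) = q i) (g : X → ι → X) (x₀ : X) {V D : X → ℝ}
    (hV : ∀ x, 0 ≤ V x) (hD : ∀ x, 0 ≤ D x) (hdesc : ∀ x, ∑ i, q i * V (g x i) ≤ V x - D x) :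
    ∀ᵐ ω ∂μ, (∃ c, Tendsto (fun k => V (randomIterate g x₀ (draw · ω) k)) atTop (𝓝 c)) ∧
      Tendsto (fun k => D (randomIterate g x₀ (draw · ω) k)) atTop (𝓝 0) := by
  refine ae_exists_tendsto_and_tendsto_zero (ℱ := pastFiltration draw hmeas)
    (fun k => stronglyMeasurable_randomIterate hmeas g x₀ k V)
    (fun k => stronglyMeasurable_randomIterate hmeas g x₀ k D)
    (fun k => integrable_randomIterate hmeas g x₀ k V)
    (fun k => integrable_randomIterate hmeas g x₀ k D)
    (fun k ω => hV _) (fun k ω => hD _) fun k => ?_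
  have hstep := condExp_apply_of_indep ((pastFiltration draw hmeas).le k) (hmeas k)
    (indep_comap_pastFiltration hmeas hindep k)
    (F := fun ω i => V (g (randomIterate g x₀ (draw · ω) k) i))
    (fun i => stronglyMeasurable_randomIterate hmeas g x₀ k fun x => V (g x i))
    (fun i => integrable_randomIterate hmeas g x₀ k fun x => V (g x i))
  filter_upwards [hstep] with ω hω
  refine hω.trans_le ?_
  simpa only [hlaw, Pi.sub_apply] using hdesc (randomIterate g x₀ (draw · ω) k)

-- Opial's argument: along the whole sequence, the limit of `ρ (x k) b` is its value at a cluster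
-- point `a`, and this is small when `b` is close to `a`.
theorem exists_tendsto_of_comparison_tendsto {X : Type*} [MetricSpace X] [ProperSpace X]
    {ρ : X → X → ℝ} (hρ : Continuous fun x : X × X => ρ x.1 x.2) (hρ_self : ∀ a, ρ a a = 0) {C : ℝ}
    (hdist : ∀ x y, dist x y ^ 2 ≤ C * ρ x y) {F D : Set X} (hD : D.Nonempty)
    (hFD : F ⊆ closure D) {x : ℕ → X}
    (hlim : ∀ b ∈ D, ∃ c, Tendsto (fun k => ρ (x k) b) atTop (𝓝 c))
    (hcluster : ∀ (a : X) (φ : ℕ → ℕ), StrictMono φ → Tendsto (x ∘ φ) atTop (𝓝 a) → a ∈ F) :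
    ∃ a ∈ F, Tendsto x atTop (𝓝 a) := by
  obtain ⟨b₀, hb₀⟩ := hD
  obtain ⟨c₀, hc₀⟩ := hlim b₀ hb₀
  obtain ⟨B, hB⟩ := (hc₀.const_mul C).bddAbove_range
  obtain ⟨a, -, φ, hφ, ha⟩ := (isCompact_closedBall b₀ √B).tendsto_subseq (x := x)
    fun k => Real.le_sqrt_of_sq_le ((hdist _ _).trans (hB ⟨k, rfl⟩))
  have haF := hcluster a φ hφ ha
  refine ⟨a, haF, Metric.tendsto_atTop.2 fun ε hε => ?_⟩
  have hnhds : ∀ᶠ b in 𝓝 a, C * ρ a b < (ε / 2) ^ 2 ∧ dist b a < ε / 2 := by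
    have hcont : Continuous fun b => C * ρ a b := by fun_prop
    exact (hcont.continuousAt.eventually_lt_const (by
      simp only [hρ_self, mul_zero]; positivity)).and
      (Metric.ball_mem_nhds a (half_pos hε))
  obtain ⟨b, ⟨hρab, hba⟩, hb⟩ := mem_closure_iff_nhds.1 (hFD haF) _ hnhds
  obtain ⟨c, hc⟩ := hlim b hb
  have hcab : c = ρ a b := tendsto_nhds_unique (hc.comp hφ.tendsto_atTop)
    ((hρ.tendsto (a, b)).comp (ha.prodMk_nhds tendsto_const_nhds))
  obtain ⟨N, hN⟩ := eventually_atTop.1 ((hc.const_mul C).eventually_lt_const (hcab ▸ hρab))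
  refine ⟨N, fun k hk => (dist_triangle _ b _).trans_lt ?_⟩
  have hxb := lt_of_pow_lt_pow_left₀ 2 (half_pos hε).le ((hdist (x k) b).trans_lt (hN k hk))
  linarith

variable {ι : Type*} [Fintype ι] {E : ι → Type*} [∀ i, MetricSpace (E i)] {p q : ι → ℝ}

/-- `T` is firmly nonexpansive towards each of its fixed points, for the distance whose square is
`weightedSqDist p`. -/
def IsFirmlyQuasinonexpansive (p : ι → ℝ) (T : (∀ i, E i) → ∀ i, E i) : Prop :=
  ∀ z z', Function.IsFixedPt T z' →
    weightedSqDist p (T z) z' + weightedSqDist p (T z) z ≤ weightedSqDist p z z'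

-- Dividing the weights by the probabilities makes the update of a random coordinate act, on
-- average, like the update of all of them.
lemma sum_mul_weightedSqDist_update [DecidableEq ι] (hq : ∀ i, q i ≠ 0) (hqsum : ∑ i, q i = 1)
    (x y v : ∀ i, E i) :
    ∑ i, q i * weightedSqDist (fun i => p i / q i) (Function.update x i (v i)) y =
      weightedSqDist (fun i => p i / q i) x y + (weightedSqDist p v y - weightedSqDist p x y) := by
  have hterm (i : ι) : q i * weightedSqDist (fun i => p i / q i) (Function.update x i (v i)) y =
      q i * weightedSqDist (fun i => p i / q i) x y +
        (p i * dist (v i) (y i) ^ 2 - p i * dist (x i) (y i) ^ 2) := by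
    rw [weightedSqDist_update]
    field_simp [hq i]
  rw [Finset.sum_congr rfl fun i _ => hterm i, Finset.sum_add_distrib, ← Finset.sum_mul, hqsum,
    one_mul, Finset.sum_sub_distrib, weightedSqDist, weightedSqDist, weightedSqDist]

lemma exists_isFixedPt_tendsto_of_weightedSqDist_tendsto [∀ i, ProperSpace (E i)] {r : ι → ℝ}
    (hp : ∀ i, 0 < p i) (hr : ∀ i, 0 < r i) {T : (∀ i, E i) → ∀ i, E i} (hT : Continuous T)
    {D : Set (∀ i, E i)} (hD : D.Nonempty) (hTD : Function.fixedPoints T ⊆ closure D)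
    {x : ℕ → ∀ i, E i}
    (hlim : ∀ b ∈ D, ∃ c, Tendsto (fun k => weightedSqDist r (x k) b) atTop (𝓝 c))
    (hres : Tendsto (fun k => weightedSqDist p (T (x k)) (x k)) atTop (𝓝 0)) :
    ∃ z, Function.IsFixedPt T z ∧ Tendsto x atTop (𝓝 z) := by
  obtain ⟨C, -, hC⟩ := exists_dist_sq_le_weightedSqDist (E := E) hr
  refine exists_tendsto_of_comparison_tendsto (X := ∀ i, E i) (ρ := weightedSqDist r)
    continuous_weightedSqDist weightedSqDist_self hC hD hTD hlim fun a φ hφ ha => ?_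
  have hcont : Continuous fun z => weightedSqDist p (T z) z :=
    continuous_weightedSqDist.comp (hT.prodMk continuous_id)
  have hzero : weightedSqDist p (T a) a = 0 :=
    tendsto_nhds_unique ((hcont.tendsto a).comp ha) (hres.comp hφ.tendsto_atTop)
  exact Function.mem_fixedPoints.2 ((weightedSqDist_eq_zero_iff hp).1 hzero)

theorem ae_exists_isFixedPt_tendsto_randomIterate_update [∀ i, ProperSpace (E i)] [DecidableEq ι]
    [MeasurableSpace ι] [MeasurableSingletonClass ι] {Ω : Type*} [MeasurableSpace Ω]
    {μ : Measure Ω} [IsProbabilityMeasure μ] (hp : ∀ i, 0 < p i) (hq : ∀ i, 0 < q i)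
    {T : (∀ i, E i) → ∀ i, E i} (hTcont : Continuous T) (hT : IsFirmlyQuasinonexpansive p T)
    (hfix : ∃ z, Function.IsFixedPt T z) {draw : ℕ → Ω → ι} (hmeas : ∀ k, Measurable (draw k))
    (hindep : iIndepFun draw μ) (hlaw : ∀ k i, μ.real (draw k ⁻¹' {i}) = q i) (z₀ : ∀ i, E i) :
    ∀ᵐ ω ∂μ, ∃ z, Function.IsFixedPt T z ∧ Tendsto
      (randomIterate (fun z i => Function.update z i (T z i)) z₀ (draw · ω)) atTop (𝓝 z) := by
  have hqsum : ∑ i, q i = 1 := by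
    simpa [hlaw] using sum_measureReal_preimage_singleton (μ := μ) Finset.univ
      (f := draw 0) fun i _ => hmeas 0 (measurableSet_singleton i)
  have hpq (i : ι) : 0 < p i / q i := div_pos (hp i) (hq i)
  obtain ⟨D, hDfix, hDcount, hDdense⟩ := TopologicalSpace.IsSeparable.of_separableSpace
    (Function.fixedPoints T) |>.exists_countable_dense_subset
  have hdesc (b) (hb : b ∈ D) (z : ∀ i, E i) :
      ∑ i, q i * weightedSqDist (fun i => p i / q i) (Function.update z i (T z i)) b ≤
        weightedSqDist (fun i => p i / q i) z b - weightedSqDist p (T z) z := by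
    rw [sum_mul_weightedSqDist_update (fun i => (hq i).ne') hqsum]
    linarith [hT z b (hDfix hb)]
  have hlyap (b) (hb : b ∈ D) := ae_tendsto_of_sum_mul_le_sub hmeas hindep hlaw
    (fun z i => Function.update z i (T z i)) z₀ (fun z => weightedSqDist_nonneg hpq z b)
    (fun z => weightedSqDist_nonneg hp (T z) z) (hdesc b hb)
  obtain ⟨z', hz'⟩ := hfix
  obtain ⟨b₀, hb₀⟩ : D.Nonempty := closure_nonempty_iff.1 ⟨z', hDdense hz'⟩
  filter_upwards [(ae_ball_iff hDcount).2 hlyap] with ω hω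
  exact exists_isFixedPt_tendsto_of_weightedSqDist_tendsto hp hpq hTcont ⟨b₀, hb₀⟩ hDdense
    (fun b hb => (hω b hb).1) (hω b₀ hb₀).2

end Convergence

section DouglasRachford

/-- `P` is the orthogonal projection onto `W` relative to the bilinear form `B`. -/
def IsOrthogonalProjection {V : Type*} [AddCommGroup V] [Module ℝ V] (B : LinearMap.BilinForm ℝ V)
    (W : Submodule ℝ V) (P : V → V) : Prop :=
  ∀ z, P z ∈ W ∧ ∀ w ∈ W, B (z - P z) w = 0

namespace IsOrthogonalProjection

lemma apply_sub_sub_apply_sub {V : Type*} [AddCommGroup V] [Module ℝ V]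
    {B : LinearMap.BilinForm ℝ V} {W : Submodule ℝ V} {P : V → V}
    (hP : IsOrthogonalProjection B W P) (z z' : V) :
    B ((z - z') - (P z - P z')) (P z - P z') = 0 := by
  have hmem : P z - P z' ∈ W := W.sub_mem (hP z).1 (hP z').1
  rw [sub_sub_sub_comm, LinearMap.map_sub₂, (hP z).2 _ hmem, (hP z').2 _ hmem, sub_zero]

variable {ι : Type*} [Fintype ι] {E : ι → Type*} [∀ i, NormedAddCommGroup (E i)]
  [∀ i, InnerProductSpace ℝ (E i)] {p : ι → ℝ} {W : Submodule ℝ (∀ i, E i)}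
  {P : (∀ i, E i) → ∀ i, E i} (hp : ∀ i, 0 < p i)
  (hP : IsOrthogonalProjection (weightedInner p) W P)
include hp hP

lemma eq_of_mem {x z : ∀ i, E i} (hx : x ∈ W) (h : ∀ w ∈ W, weightedInner p (z - x) w = 0) :
    P z = x := by
  have hmem : P z - x ∈ W := W.sub_mem (hP z).1 hx
  rw [← weightedSqDist_eq_zero_iff hp, ← weightedInner_sub_self]
  nth_rw 1 [← sub_sub_sub_cancel_left x (P z) z]
  rw [LinearMap.map_sub₂, h _ hmem, (hP z).2 _ hmem, sub_zero]

lemma continuous : Continuous P := by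
  refine continuous_of_weightedSqDist_le hp fun z z' => ?_
  have hnonneg := weightedSqDist_nonneg hp (z - z') (P z - P z')
  have horth := hP.apply_sub_sub_apply_sub z z'
  simp only [← weightedInner_sub_self] at hnonneg ⊢
  simp only [map_sub, LinearMap.sub_apply] at horth hnonneg ⊢
  simp only [weightedInner_isSymm.eq] at horth hnonneg ⊢
  linarith

end IsOrthogonalProjection

-- With `a`, `b`, `c` the differences of two points, of their projections and of the resulting
-- proximal points, this is the firm nonexpansiveness of the Douglas–Rachford operator.
lemma apply_add_sub_self_add_apply_sub_self_le {V : Type*} [AddCommGroup V] [Module ℝ V]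
    {B : LinearMap.BilinForm ℝ V} (hB : B.IsSymm) {a b c : V} (hb : B (a - b) b = 0)
    (hc : 0 ≤ B ((2 : ℝ) • b - a - c) c) :
    B (a + c - b) (a + c - b) + B (c - b) (c - b) ≤ B a a := by
  have hac := hB.eq a c
  have hbc := hB.eq b c
  have hab := hB.eq a b
  simp only [map_sub, map_add, map_smul, LinearMap.sub_apply, LinearMap.add_apply,
    LinearMap.smul_apply, smul_eq_mul] at *
  linarith

variable {ι : Type*} {E : ι → Type*} [∀ i, NormedAddCommGroup (E i)]
  [∀ i, InnerProductSpace ℝ (E i)]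

/-- The Douglas–Rachford operator of the separable function with terms `f i` and of the projection
`P` onto the constraint set. -/
def douglasRachford (f : ∀ i, E i → EReal) (mu : ℝ) (P : (∀ i, E i) → ∀ i, E i) (z : ∀ i, E i) :
    ∀ i, E i :=
  fun i => z i + proxPoint (f i) mu ((2 : ℝ) • P z i - z i) - P z i

variable [Fintype ι] [∀ i, FiniteDimensional ℝ (E i)] {p : ι → ℝ} {f : ∀ i, E i → EReal}
  {W : Submodule ℝ (∀ i, E i)} {P : (∀ i, E i) → ∀ i, E i} {mu : ℝ}
  (hp : ∀ i, 0 < p i) (hf : ∀ i, IsClosedProperConvex (f i))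
  (hP : IsOrthogonalProjection (weightedInner p) W P) (hmu : 0 < mu)
include hp hf hP hmu

lemma weightedSqDist_douglasRachford_add_le (z z' : ∀ i, E i) :
    weightedSqDist p (douglasRachford f mu P z) (douglasRachford f mu P z') +
      weightedSqDist p (douglasRachford f mu P z - z) (douglasRachford f mu P z' - z') ≤
    weightedSqDist p z z' := by
  let c (z : ∀ i, E i) : ∀ i, E i := (2 : ℝ) • P z - z
  let prox (z : ∀ i, E i) : ∀ i, E i := fun i => proxPoint (f i) mu (c z i)
  have hT : douglasRachford f mu P z - douglasRachford f mu P z' =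
      z - z' + (prox z - prox z') - (P z - P z') :=
    (sub_sub_sub_comm _ _ _ _).trans (congrArg (· - (P z - P z')) (add_sub_add_comm _ _ _ _))
  have hstep : ∀ z, douglasRachford f mu P z - z = prox z - P z := fun z =>
    (sub_right_comm _ _ _).trans (congrArg (· - P z) (add_sub_cancel_left _ _))
  have hprox : 0 ≤ weightedInner p (c z - c z' - (prox z - prox z')) (prox z - prox z') := by
    rw [weightedInner_apply]
    exact Finset.sum_nonneg fun i _ => mul_nonneg (hp i).le
      (((hf i).isSubgradientAt_proxPoint hmu (c z i)).inner_sub_sub_nonneg hmu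
        ((hf i).isSubgradientAt_proxPoint hmu (c z' i)))
  rw [show c z - c z' = (2 : ℝ) • (P z - P z') - (z - z') by simp only [c]; module] at hprox
  rw [← weightedInner_sub_self, ← weightedInner_sub_self, ← weightedInner_sub_self, hT, hstep,
    hstep, sub_sub_sub_comm]
  exact apply_add_sub_self_add_apply_sub_self_le weightedInner_isSymm
    (hP.apply_sub_sub_apply_sub z z') hprox

lemma continuous_douglasRachford : Continuous (douglasRachford f mu P) :=
  continuous_of_weightedSqDist_le hp fun z z' =>
    le_of_add_le_of_nonneg_left (weightedSqDist_douglasRachford_add_le hp hf hP hmu z z')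
      (weightedSqDist_nonneg hp _ _)

lemma isFirmlyQuasinonexpansive_douglasRachford :
    IsFirmlyQuasinonexpansive p (douglasRachford f mu P) := by
  intro z z' hz'
  have h := weightedSqDist_douglasRachford_add_le hp hf hP hmu z z'
  rw [hz'.eq, sub_self, ← weightedInner_sub_self (_ - _), sub_zero, weightedInner_sub_self] at h
  exact h

lemma isMinOn_of_isFixedPt_douglasRachford {z : ∀ i, E i}
    (hz : Function.IsFixedPt (douglasRachford f mu P) z) : IsMinOn (weightedSum p f) W (P z) := by
  refine isMinOn_of_multiplier hp (fun i => (hf i).proper.1) (hP z).1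
    (u := -mu⁻¹ • (z - P z)) (fun w hw => ?_) fun i => ?_
  · rw [map_smul, LinearMap.smul_apply, (hP z).2 w hw, smul_zero]
  · have hprox : proxPoint (f i) mu ((2 : ℝ) • P z i - z i) = P z i := by
      have h : z i + proxPoint (f i) mu ((2 : ℝ) • P z i - z i) - P z i = z i := congrFun hz i
      rwa [add_sub_assoc, add_eq_left, sub_eq_zero] at h
    have h := (hf i).isSubgradientAt_proxPoint hmu ((2 : ℝ) • P z i - z i)
    rw [hprox] at h
    convert h using 1
    simp only [Pi.smul_apply, Pi.sub_apply]
    module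

lemma exists_isFixedPt_douglasRachford
    (hri : ((W : Set (∀ i, E i)) ∩ intrinsicInterior ℝ {x | weightedSum p f x < ⊤}).Nonempty)
    {x : ∀ i, E i} (hxW : x ∈ W) (hx : IsMinOn (weightedSum p f) W x) :
    ∃ z, Function.IsFixedPt (douglasRachford f mu P) z := by
  obtain ⟨u, hu, hsub⟩ := exists_multiplier hp (fun i => (hf i).convex)
    (fun i => (hf i).proper.1) hri hxW hx
  have hproj : P (x - mu • u) = x := hP.eq_of_mem hp hxW fun w hw => by
    rw [sub_sub_cancel_left, map_neg, map_smul, LinearMap.neg_apply, LinearMap.smul_apply, hu w hw,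
      smul_zero, neg_zero]
  refine ⟨x - mu • u, funext fun i => ?_⟩
  rw [douglasRachford, hproj, (hf i).proxPoint_eq (y := x i) hmu, add_sub_cancel_right]
  convert hsub i using 1
  rw [inv_smul_eq_iff₀ hmu.ne', Pi.sub_apply, Pi.smul_apply]
  module

theorem ae_exists_isMinOn_tendsto_randomIterate [DecidableEq ι] [MeasurableSpace ι]
    [MeasurableSingletonClass ι] {Ω : Type*} [MeasurableSpace Ω] {μ : Measure Ω}
    [IsProbabilityMeasure μ]
    (hri : ((W : Set (∀ i, E i)) ∩ intrinsicInterior ℝ {x | weightedSum p f x < ⊤}).Nonempty)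
    (hsol : ∃ x ∈ W, IsMinOn (weightedSum p f) W x) {q : ι → ℝ} (hq : ∀ i, 0 < q i)
    {draw : ℕ → Ω → ι} (hmeas : ∀ k, Measurable (draw k)) (hindep : iIndepFun draw μ)
    (hlaw : ∀ k i, μ.real (draw k ⁻¹' {i}) = q i) (z₀ : ∀ i, E i) :
    ∀ᵐ ω ∂μ, ∃ x ∈ W, IsMinOn (weightedSum p f) W x ∧
      Tendsto (fun k => P (randomIterate
        (fun z i => Function.update z i (douglasRachford f mu P z i)) z₀ (draw · ω) k))
        atTop (𝓝 x) := by
  obtain ⟨x, hxW, hx⟩ := hsol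
  filter_upwards [ae_exists_isFixedPt_tendsto_randomIterate_update hp hq
    (continuous_douglasRachford hp hf hP hmu)
    (isFirmlyQuasinonexpansive_douglasRachford hp hf hP hmu)
    (exists_isFixedPt_douglasRachford hp hf hP hmu hri hxW hx) hmeas hindep hlaw z₀]
    with ω ⟨z, hz, hlim⟩
  exact ⟨P z, (hP z).1, isMinOn_of_isFixedPt_douglasRachford hp hf hP hmu hz,
    ((hP.continuous hp).tendsto z).comp hlim⟩

end DouglasRachford

namespace MultistageProblem

variable {S T : ℕ} {n : Fin T → ℕ} {Ξ : Fin (T - 1) → Type*} {M : MultistageProblem S T n Ξ}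

lemma subproblem_eq_proxObjective (mu : ℝ) (z : FullVar S n) (s : Fin S) :
    M.subproblem mu z s = proxObjective (M.cost s) mu ((2 : ℝ) • M.bundleAvg z s - z s) := by
  funext y
  rw [subproblem, proxObjective, sub_add]

lemma rphIterate_eq_randomIterate (mu : ℝ) (z₀ : FullVar S n) (draw : ℕ → Fin S) (k : ℕ) :
    M.rphIterate mu z₀ draw k = randomIterate
      (fun z s => Function.update z s (douglasRachford M.cost mu M.bundleAvg z s)) z₀ draw k := by
  induction k with
  | zero => rfl
  | succ k ih =>
    rw [rphIterate, randomIterate, ← ih, rphStep, subproblem_eq_proxObjective]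
    rfl

lemma mem_bundle {s σ : Fin S} {t : Fin T} : σ ∈ M.bundle s t ↔ M.SameHistory t s σ := by
  simp [bundle]

lemma SameHistory.symm {t : Fin T} {s σ : Fin S} (h : M.SameHistory t s σ) :
    M.SameHistory t σ s := fun τ hτ => (h τ hτ).symm

lemma SameHistory.trans {t : Fin T} {s σ ρ : Fin S} (h : M.SameHistory t s σ)
    (h' : M.SameHistory t σ ρ) : M.SameHistory t s ρ := fun τ hτ => (h τ hτ).trans (h' τ hτ)

lemma SameHistory.bundle_eq {t : Fin T} {s σ : Fin S} (h : M.SameHistory t s σ) :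
    M.bundle s t = M.bundle σ t := by
  ext ρ
  rw [mem_bundle, mem_bundle]
  exact ⟨h.symm.trans, h.trans⟩

lemma bundleAvg_apply (z : FullVar S n) (s : Fin S) (t : Fin T) :
    M.bundleAvg z s t =
      (∑ σ ∈ M.bundle s t, M.prob σ)⁻¹ • ∑ σ ∈ M.bundle s t, M.prob σ • z σ t := rfl

lemma bundleAvg_mem_nonanticipative (z : FullVar S n) : M.bundleAvg z ∈ M.nonanticipative := by
  intro t s σ h
  rw [bundleAvg_apply, bundleAvg_apply, h.bundle_eq]

lemma sum_prob_bundle_pos (hprob : ∀ s, 0 < M.prob s) (s : Fin S) (t : Fin T) :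
    0 < ∑ σ ∈ M.bundle s t, M.prob σ :=
  Finset.sum_pos (fun σ _ => hprob σ) ⟨s, mem_bundle.2 fun _ _ => rfl⟩

lemma sum_inner_bundleAvg_apply (hprob : ∀ s, 0 < M.prob s) (z : FullVar S n) {w : FullVar S n}
    (hw : w ∈ M.nonanticipative) (t : Fin T) :
    ∑ s, M.prob s * ⟪M.bundleAvg z s t, w s t⟫_ℝ = ∑ s, M.prob s * ⟪z s t, w s t⟫_ℝ :=
  calc ∑ s, M.prob s * ⟪M.bundleAvg z s t, w s t⟫_ℝ
      = ∑ s, ∑ σ ∈ M.bundle s t, M.prob s * ((∑ ρ ∈ M.bundle σ t, M.prob ρ)⁻¹ *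
          (M.prob σ * ⟪z σ t, w σ t⟫_ℝ)) := by
        refine Finset.sum_congr rfl fun s _ => ?_
        rw [bundleAvg_apply, real_inner_smul_left, sum_inner, Finset.mul_sum, Finset.mul_sum]
        refine Finset.sum_congr rfl fun σ hσ => ?_
        rw [real_inner_smul_left, (mem_bundle.1 hσ).bundle_eq, hw t s σ (mem_bundle.1 hσ)]
    _ = ∑ σ, ∑ s ∈ M.bundle σ t, M.prob s * ((∑ ρ ∈ M.bundle σ t, M.prob ρ)⁻¹ *
          (M.prob σ * ⟪z σ t, w σ t⟫_ℝ)) :=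
        Finset.sum_comm' fun s σ => by
          simpa only [Finset.mem_univ, true_and, and_true, mem_bundle] using
            ⟨SameHistory.symm, SameHistory.symm⟩
    _ = ∑ σ, M.prob σ * ⟪z σ t, w σ t⟫_ℝ := by
        refine Finset.sum_congr rfl fun σ _ => ?_
        rw [← Finset.sum_mul, mul_inv_cancel_left₀ (sum_prob_bundle_pos hprob σ t).ne']

lemma isOrthogonalProjection_bundleAvg (hprob : ∀ s, 0 < M.prob s) :
    IsOrthogonalProjection (weightedInner M.prob) M.nonanticipative M.bundleAvg := by
  refine fun z => ⟨bundleAvg_mem_nonanticipative z, fun w hw => ?_⟩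
  have hinner : ∀ x y : Decision n, ⟪x, y⟫_ℝ = ∑ t, ⟪x t, y t⟫_ℝ := PiLp.inner_apply
  rw [LinearMap.map_sub₂, sub_eq_zero, weightedInner_apply, weightedInner_apply]
  simp only [hinner, Finset.mul_sum]
  rw [Finset.sum_comm, Finset.sum_comm (t := Finset.univ (α := Fin T))]
  exact Finset.sum_congr rfl fun t _ => (sum_inner_bundleAvg_apply hprob z hw t).symm

end MultistageProblem

end

theorem theorem2_general {S T : ℕ} {n : Fin T → ℕ} {Ξ : Fin (T - 1) → Type*}
    (M : MultistageProblem S T n Ξ)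
    (hprob : ∀ s, 0 < M.prob s)
    (hconvex : ∀ s, ConvexEReal (M.cost s))
    (hproper : ∀ s, ProperEReal (M.cost s))
    (hlsc : ∀ s, LowerSemicontinuous (M.cost s))
    (hsol : ∃ x, M.IsSolution x)
    (hri : ((M.nonanticipative : Set (FullVar S n)) ∩ intrinsicInterior ℝ M.domain).Nonempty)
    (mu : ℝ) (hmu : 0 < mu)
    (z₀ : FullVar S n)
    (q : Fin S → ℝ) (hq : ∀ s, 0 < q s)
    {Ω : Type*} [MeasurableSpace Ω] (Pr : Measure Ω) [IsProbabilityMeasure Pr]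
    (draw : ℕ → Ω → Fin S)
    (hmeas : ∀ k, Measurable (draw k))
    (hindep : iIndepFun draw Pr)
    (hlaw : ∀ k s, Pr.real {ω | draw k ω = s} = q s) :
    (∀ (z : FullVar S n) (s : Fin S), ∃! y, IsMinOn (M.subproblem mu z s) Set.univ y) ∧
    (∀ᵐ ω ∂Pr, ∀ k, M.rphOutput mu z₀ (fun j => draw j ω) k ∈ M.nonanticipative) ∧
    (∀ᵐ ω ∂Pr, ∃ x, M.IsSolution x ∧
      Tendsto (fun k => M.rphOutput mu z₀ (fun j => draw j ω) k) atTop (𝓝 x)) := by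
  have hf (s) : IsClosedProperConvex (M.cost s) := ⟨hconvex s, hproper s, hlsc s⟩
  refine ⟨fun z s => ?_, ae_of_all _ fun ω k =>
    MultistageProblem.bundleAvg_mem_nonanticipative _, ?_⟩
  · rw [MultistageProblem.subproblem_eq_proxObjective]
    exact (hf s).existsUnique_isMinOn_proxObjective hmu _
  · filter_upwards [ae_exists_isMinOn_tendsto_randomIterate hprob hf
      (MultistageProblem.isOrthogonalProjection_bundleAvg hprob) hmu hri hsol hq hmeas hindep hlaw
      z₀] with ω ⟨x, hxW, hx, hlim⟩
    refine ⟨x, ⟨hxW, hx⟩, hlim.congr fun k => ?_⟩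
    rw [← MultistageProblem.rphIterate_eq_randomIterate]
    rfl

theorem theorem2 {S T : ℕ} {n : Fin T → ℕ} {Ξ : Fin (T - 1) → Type*}
    (M : MultistageProblem S T n Ξ)
    (hprob : ∀ s, 0 < M.prob s)
    (hconvex : ∀ s, ConvexEReal (M.cost s))
    (hproper : ∀ s, ProperEReal (M.cost s))
    (hlsc : ∀ s, LowerSemicontinuous (M.cost s))
    (hsol : ∃ x, M.IsSolution x)
    (hri : ((M.nonanticipative : Set (FullVar S n)) ∩ intrinsicInterior ℝ M.domain).Nonempty)
    (mu : ℝ) (hmu : 0 < mu)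
    (z₀ : FullVar S n) (hz₀ : z₀ ∈ M.nonanticipative)
    (q : Fin S → ℝ) (hq : ∀ s, 0 < q s)
    {Ω : Type*} [MeasurableSpace Ω] (Pr : Measure Ω) [IsProbabilityMeasure Pr]
    (draw : ℕ → Ω → Fin S)
    (hmeas : ∀ k, Measurable (draw k))
    (hindep : iIndepFun draw Pr)
    (hlaw : ∀ k s, Pr.real {ω | draw k ω = s} = q s) :
    (∀ (z : FullVar S n) (s : Fin S), ∃! y, IsMinOn (M.subproblem mu z s) Set.univ y) ∧
    (∀ᵐ ω ∂Pr, ∀ k, M.rphOutput mu z₀ (fun j => draw j ω) k ∈ M.nonanticipative) ∧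
    (∀ᵐ ω ∂Pr, ∃ x, M.IsSolution x ∧
      Tendsto (fun k => M.rphOutput mu z₀ (fun j => draw j ω) k) atTop (𝓝 x)) :=
  theorem2_general M hprob hconvex hproper hlsc hsol hri mu hmu z₀ q hq Pr draw hmeas hindep hlaw
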